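/- Let $f,g:[0,1]\to[0,1]$ be given by $$f(x)=\begin{cases}3x & \text{if } x\in[0,\tfrac13],\\ -3x+2 & \text{if } x\in(\tfrac13,\tfrac23),\\ 3x-2 & \text{if } x\in[\tfrac23,1],\end{cases}\qquad g(x)=\tfrac13x,$$ and let $p\in[0,1]$. Let $\omega_1,\omega_2,\ldots$ be independent random maps, each equal to $f$ with probability $p$ and to $g$ with probability $1-p$. For $x\in[0,1]$ put $x_0=x$ and $x_n=\omega_n(x_{n-1})$ for $n\ge1$. For $x,y\in[0,1]$ and real $t$, let $x_n$ and $y_n$ be the trajectories of $x$ and $y$ driven by the same sequence $\omega_1,\omega_2,\ldots$, and define $$F_{xy}^{(n)}(t)=\frac1n\sum_{i=0}^{n-1}P(|x_i-y_i|<t),\qquad F_{xy}(t)=\liminf_{n\to\infty}F_{xy}^{(n)}(t),\qquad F_{xy}^\star(t)=\limsup_{n\to\infty}F_{xy}^{(n)}(t),$$ $$\mu(f,g)=\sup_{x,y\in[0,1]}\int_0^1\bigl(F_{xy}^\star(t)-F_{xy}(t)\bigr)\,\mathrm dt.$$ 1. If $p>\tfrac12$, then for $y=0$ there exists a sequence $\{x^{(k)}\}_{k=1}^\infty$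 of points in $[0,1]$ such that $$\lim_{k\to\infty}\int_0^1\bigl(F_{x^{(k)}y}^\star(t)-F_{x^{(k)}y}(t)\bigr)\,\mathrm dt=\frac{6p-3}{4p-1}.$$ 2. The measure of chaos of the system is $$\mu(f,g)=\begin{cases}0 & \text{if } p<\tfrac12,\\[2pt] \dfrac{6p-3}{4p-1} & \text{if } p\ge\tfrac12.\end{cases}$$ -/

import Mathlib

open MeasureTheory ProbabilityTheory Filter Topology

noncomputable section

/-- The coin-tossing law on `{true, false}^ℕ`: the coordinates are independent, each of them is
`true` with probability `p` and `false` with probability `1 - p`. The coordinate `ω n` encodes the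
map that is applied in step `n + 1`: `true` stands for `f` and `false` for `g`. -/
def choiceLaw (p : unitInterval) : Measure (ℕ → Bool) :=
  Measure.infinitePi fun _ => bernoulliMeasure true false p

instance choiceLaw_isProbabilityMeasure (p : unitInterval) :
    IsProbabilityMeasure (choiceLaw p) := by
  unfold choiceLaw; infer_instance

section RandomSystem

variable {a b : ℝ} (f g : Set.Icc a b → Set.Icc a b)

/-- The trajectory `x₀ = x`, `xₙ₊₁ = f xₙ` or `xₙ₊₁ = g xₙ` according to the choice `ω n`. -/
def trajectory (ω : ℕ → Bool) (x : Set.Icc a b) : ℕ → Set.Icc a b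
  | 0 => x
  | n + 1 => if ω n = true then f (trajectory ω x n) else g (trajectory ω x n)

/-- `F_{xy}^{(n)}(t) = (1/n) (P(|x₀ - y₀| < t) + ... + P(|xₙ₋₁ - yₙ₋₁| < t))`. -/
def distFun (p : unitInterval) (x y : Set.Icc a b) (n : ℕ) (t : ℝ) : ℝ :=
  (1 / (n : ℝ)) * ∑ i ∈ Finset.range n,
    (choiceLaw p).real {ω | |(trajectory f g ω x i : ℝ) - (trajectory f g ω y i : ℝ)| < t}

/-- The lower distribution function `F_{xy}(t)`. -/
def lowerDistFun (p : unitInterval) (x y : Set.Icc a b) (t : ℝ) : ℝ :=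
  liminf (fun n : ℕ => distFun f g p x y n t) atTop

/-- The upper distribution function `F_{xy}^*(t)`. -/
def upperDistFun (p : unitInterval) (x y : Set.Icc a b) (t : ℝ) : ℝ :=
  limsup (fun n : ℕ => distFun f g p x y n t) atTop

/-- The area `∫₀^{|I|} (F_{xy}^*(t) - F_{xy}(t)) dt` between the two distribution functions,
for `I = [a, b]`. -/
def distArea (p : unitInterval) (x y : Set.Icc a b) : ℝ :=
  ∫ t in (0 : ℝ)..(b - a), (upperDistFun f g p x y t - lowerDistFun f g p x y t)

/-- The measure of chaos `sup_{x, y ∈ I} (1/|I|) ∫₀^{|I|} (F_{xy}^*(t) - F_{xy}(t)) dt`. -/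
def chaosMeasure (p : unitInterval) : ℝ :=
  ⨆ q : Set.Icc a b × Set.Icc a b, (1 / (b - a)) * distArea f g p q.1 q.2

/-! The limits, the integral and the supremum above are genuine, as the following facts show:
all the functions are bounded and monotone in `t`. -/

lemma distFun_mem (p : unitInterval) (x y : Set.Icc a b) (n : ℕ) (t : ℝ) :
    distFun f g p x y n t ∈ Set.Icc (0 : ℝ) 1 := by
  unfold distFun
  refine ⟨by positivity, ?_⟩
  rcases Nat.eq_zero_or_pos n with rfl | hn
  · simp
  · have h : ∑ i ∈ Finset.range n, (choiceLaw p).real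
        {ω | |(trajectory f g ω x i : ℝ) - (trajectory f g ω y i : ℝ)| < t} ≤ n := by
      refine (Finset.sum_le_sum fun i _ => measureReal_le_one).trans ?_
      simp
    have hn' : (0 : ℝ) < n := by exact_mod_cast hn
    rw [one_div, inv_mul_le_iff₀ hn']
    simpa using h

lemma distFun_mono (p : unitInterval) (x y : Set.Icc a b) (n : ℕ) :
    Monotone (distFun f g p x y n) := by
  intro s t hst
  unfold distFun
  refine mul_le_mul_of_nonneg_left (Finset.sum_le_sum fun i _ => ?_) (by positivity)
  exact measureReal_mono fun ω (hω : _ < s) => lt_of_lt_of_le hω hst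

lemma distFun_bddAbove (p : unitInterval) (x y : Set.Icc a b) (t : ℝ) :
    IsBoundedUnder (· ≤ ·) atTop (fun n : ℕ => distFun f g p x y n t) :=
  isBoundedUnder_of ⟨1, fun n => (distFun_mem f g p x y n t).2⟩

lemma distFun_bddBelow (p : unitInterval) (x y : Set.Icc a b) (t : ℝ) :
    IsBoundedUnder (· ≥ ·) atTop (fun n : ℕ => distFun f g p x y n t) :=
  isBoundedUnder_of ⟨0, fun n => (distFun_mem f g p x y n t).1⟩

lemma lowerDistFun_mono (p : unitInterval) (x y : Set.Icc a b) :
    Monotone (lowerDistFun f g p x y) := fun s t hst =>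
  liminf_le_liminf (Eventually.of_forall fun n => distFun_mono f g p x y n hst)
    (distFun_bddBelow f g p x y s) (distFun_bddAbove f g p x y t).isCoboundedUnder_ge

lemma upperDistFun_mono (p : unitInterval) (x y : Set.Icc a b) :
    Monotone (upperDistFun f g p x y) := fun s t hst =>
  limsup_le_limsup (Eventually.of_forall fun n => distFun_mono f g p x y n hst)
    (distFun_bddBelow f g p x y s).isCoboundedUnder_le (distFun_bddAbove f g p x y t)

lemma lowerDistFun_nonneg (p : unitInterval) (x y : Set.Icc a b) (t : ℝ) :
    0 ≤ lowerDistFun f g p x y t :=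
  le_liminf_of_le (distFun_bddAbove f g p x y t).isCoboundedUnder_ge
    (Eventually.of_forall fun n => (distFun_mem f g p x y n t).1)

lemma upperDistFun_le_one (p : unitInterval) (x y : Set.Icc a b) (t : ℝ) :
    upperDistFun f g p x y t ≤ 1 :=
  limsup_le_of_le (distFun_bddBelow f g p x y t).isCoboundedUnder_le
    (Eventually.of_forall fun n => (distFun_mem f g p x y n t).2)

lemma intervalIntegrable_upper_sub_lower (p : unitInterval) (x y : Set.Icc a b) (c d : ℝ) :
    IntervalIntegrable (fun t => upperDistFun f g p x y t - lowerDistFun f g p x y t)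
      volume c d :=
  (upperDistFun_mono f g p x y).intervalIntegrable.sub
    (lowerDistFun_mono f g p x y).intervalIntegrable

lemma distArea_le (p : unitInterval) (x y : Set.Icc a b) : distArea f g p x y ≤ b - a := by
  have hab : (0 : ℝ) ≤ b - a := sub_nonneg.2 (x.2.1.trans x.2.2)
  have h := intervalIntegral.integral_mono_on hab
    (intervalIntegrable_upper_sub_lower f g p x y 0 (b - a))
    (intervalIntegrable_const (c := (1 : ℝ))) fun t _ => by
      have h1 := upperDistFun_le_one f g p x y t
      have h2 := lowerDistFun_nonneg f g p x y t
      linarith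
  simpa [distArea] using h

lemma bddAbove_distArea (p : unitInterval) :
    BddAbove (Set.range fun q : Set.Icc a b × Set.Icc a b =>
      (1 / (b - a)) * distArea f g p q.1 q.2) := by
  refine ⟨1, ?_⟩
  rintro _ ⟨q, rfl⟩
  have hab : (0 : ℝ) ≤ b - a := sub_nonneg.2 (q.1.2.1.trans q.1.2.2)
  have h := distArea_le f g p q.1 q.2
  calc (1 / (b - a)) * distArea f g p q.1 q.2 ≤ (1 / (b - a)) * (b - a) :=
        mul_le_mul_of_nonneg_left h (by positivity)
    _ ≤ 1 := by rw [one_div]; exact inv_mul_le_one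

end RandomSystem

/-- The tent-like map with three full branches: `3x` on `[0, 1/3]`, `-3x + 2` on `(1/3, 2/3)` and
`3x - 2` on `[2/3, 1]`. -/
def zigzag (x : Set.Icc (0 : ℝ) 1) : Set.Icc (0 : ℝ) 1 :=
  ⟨if (x : ℝ) ≤ 1 / 3 then 3 * (x : ℝ)
    else if (x : ℝ) < 2 / 3 then -3 * (x : ℝ) + 2
    else 3 * (x : ℝ) - 2, by
    have h0 := x.2.1
    have h1 := x.2.2
    split_ifs <;> constructor <;> linarith⟩

/-- The contraction `x ↦ x / 3`. -/
def third (x : Set.Icc (0 : ℝ) 1) : Set.Icc (0 : ℝ) 1 :=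
  ⟨(1 / 3) * (x : ℝ), by
    have h0 := x.2.1
    have h1 := x.2.2
    constructor <;> linarith⟩

end

/-! Write `f` for `zigzag` and `g` for `third`. Since `f ∘ g = id`, the composition of the first `n`
random maps reduces to `g^[b] ∘ f^[a]` (`trajectory_eq_iterate`), so `|xₙ - yₙ| = 3⁻ᵇ |f^[a] x -
f^[a] y| ≤ 3⁻ᵇ`. Here `b` is a random walk reflected at `0`, going up with probability `1 - p`.
Upper bound: `P(b ≥ m)` increases with `n` to a limit, which is `1` for `p ≤ 1/2` and `r ^ m` with
`r = (1 - p) / p` for `p > 1/2`. By Cesàro this limit bounds the lower distribution function from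
below at every `t > 3⁻ᵐ`, for every pair of points (`surplusLimit_le_lowerDistFun`). The upper one
is at most `1`; integrating the difference over the scales `(3⁻ᵐ, 3⁻ᵐ⁺¹]` gives `0` or `(6p - 3) /
(4p - 1)`. Sharpness for `p > 1/2`: `a` tends to infinity in probability. Against the fixed point
`0`, take a Cantor point whose `f`-orbit stays near `0` and near `1` alternately, in blocks so long
that the averages forget the past. Along the blocks near `0` the averages tend to `1`; along those
near `1` the distance is about `3⁻ᵇ`, so they come down to the lower bound
(`exists_extremal_point`). A single point thus attains the supremum. -/

/-! ### Independence of the past and the present choice -/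

/-- An event determined by the first `n` choices is independent of the choice `ω n`. -/
lemma choiceLaw_real_inter_eval (p : unitInterval) (n : ℕ) (E : Set (ℕ → Bool))
    (hE : ∀ ω ω' : ℕ → Bool, (∀ i < n, ω i = ω' i) → ω ∈ E → ω' ∈ E) (c : Bool) :
    (choiceLaw p).real (E ∩ {ω | ω n = c}) =
      (choiceLaw p).real E * (if c = true then (p : ℝ) else 1 - p) := by
  have hind : iIndepFun (fun (i : ℕ) (ω : ℕ → Bool) => ω i) (choiceLaw p) :=
    iIndepFun_infinitePi (X := fun _ (b : Bool) => b) fun _ => measurable_id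
  have h2 := hind.indepFun_finset (Finset.range n) {n} (by simp) fun i => measurable_pi_apply i
  have hm : (choiceLaw p).real {ω | ω n = c} = if c = true then (p : ℝ) else 1 - p := by
    have h1 : (choiceLaw p).map (fun ω => ω n) = bernoulliMeasure true false p :=
      Measure.infinitePi_map_eval _ n
    have h3 : (choiceLaw p).real {ω | ω n = c} = (bernoulliMeasure true false p).real {c} := by
      rw [← h1, map_measureReal_apply (measurable_pi_apply n) (measurableSet_singleton c)]
      rfl
    rw [h3, bernoulliMeasure_real_apply p (measurableSet_singleton c)]
    cases c <;> simp
  -- Every subset of a finite cube is measurable, so dependence on a prefix alone makes `E` a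
  -- measurable event of the past.
  have hEpre : E = (fun (ω : ℕ → Bool) (i : Finset.range n) => ω i) ⁻¹'
      {u | ∃ ω ∈ E, ∀ i : Finset.range n, ω i = u i} := by
    ext ω
    constructor
    · exact fun h => ⟨ω, h, fun _ => rfl⟩
    · rintro ⟨ω', h, h'⟩
      exact hE ω' ω (fun i hi => h' ⟨i, Finset.mem_range.2 hi⟩) h
  have hCpre : {ω : ℕ → Bool | ω n = c} =
      (fun (ω : ℕ → Bool) (i : ({n} : Finset ℕ)) => ω i) ⁻¹'
        {u | u ⟨n, Finset.mem_singleton_self n⟩ = c} := rfl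
  rw [← hm]
  have := h2.measure_inter_preimage_eq_mul
    {u | ∃ ω ∈ E, ∀ i : Finset.range n, ω i = u i}
    {u | u ⟨n, Finset.mem_singleton_self n⟩ = c} (Set.toFinite _).measurableSet
    (Set.toFinite _).measurableSet
  rw [← hEpre, ← hCpre] at this
  simp only [measureReal_def, this, ENNReal.toReal_mul]

/-! ### Reduction of words in the two maps -/

/-- The pair `(a, b)` such that the random composition of the first `n` maps is `g^[b] ∘ f^[a]`
whenever `f ∘ g = id`. -/
def reducedWord (ω : ℕ → Bool) : ℕ → ℕ × ℕ
  | 0 => (0, 0)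
  | n + 1 =>
    if ω n = true then
      (if (reducedWord ω n).2 = 0 then ((reducedWord ω n).1 + 1, 0)
        else ((reducedWord ω n).1, (reducedWord ω n).2 - 1))
    else ((reducedWord ω n).1, (reducedWord ω n).2 + 1)

lemma reducedWord_congr {ω ω' : ℕ → Bool} {n : ℕ} (h : ∀ i < n, ω i = ω' i) :
    reducedWord ω n = reducedWord ω' n := by
  induction n with
  | zero => rfl
  | succ n ih =>
    have h1 := ih fun i hi => h i (by omega)
    have h2 := h n (by omega)
    simp only [reducedWord, h1, h2]

lemma reducedWord_fst_le (ω : ℕ → Bool) (n : ℕ) : (reducedWord ω n).1 ≤ n := by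
  induction n with
  | zero => simp [reducedWord]
  | succ n ih =>
    simp only [reducedWord]
    split_ifs <;> simp only <;> omega

/-- A new `f` cancels the outermost `g` if there is one and otherwise joins the block of `f`'s; a
new `g` always stays. -/
lemma trajectory_eq_iterate {a b : ℝ} {f g : Set.Icc a b → Set.Icc a b}
    (hfg : Function.LeftInverse f g) (ω : ℕ → Bool) (x : Set.Icc a b) (n : ℕ) :
    trajectory f g ω x n = g^[(reducedWord ω n).2] (f^[(reducedWord ω n).1] x) := by
  induction n with
  | zero => rfl
  | succ n ih =>
    simp only [trajectory, reducedWord, ih]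
    split_ifs with h1 h2
    · simp [h2, Function.iterate_succ_apply']
    · obtain ⟨k, hk⟩ := Nat.exists_eq_succ_of_ne_zero h2
      simp [hk, Function.iterate_succ_apply', hfg _]
    · simp [Function.iterate_succ_apply']

/-- The law of the reduced word after `n` steps. -/
noncomputable def wordProb (p : unitInterval) (n : ℕ) (A : Set (ℕ × ℕ)) : ℝ :=
  (choiceLaw p).real {ω | reducedWord ω n ∈ A}

lemma measurableSet_of_prefix {n : ℕ} {E : Set (ℕ → Bool)}
    (hE : ∀ ω ω' : ℕ → Bool, (∀ i < n, ω i = ω' i) → ω ∈ E → ω' ∈ E) : MeasurableSet E := by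
  have hEpre : E = (fun (ω : ℕ → Bool) (i : Finset.range n) => ω i) ⁻¹'
      {u | ∃ ω ∈ E, ∀ i : Finset.range n, ω i = u i} := by
    ext ω
    constructor
    · exact fun h => ⟨ω, h, fun _ => rfl⟩
    · rintro ⟨ω', h, h'⟩
      exact hE ω' ω (fun i hi => h' ⟨i, Finset.mem_range.2 hi⟩) h
  rw [hEpre]
  exact (measurable_pi_lambda _ fun i => measurable_pi_apply _) (Set.toFinite _).measurableSet

lemma measurableSet_reducedWord (n : ℕ) (A : Set (ℕ × ℕ)) :
    MeasurableSet {ω : ℕ → Bool | reducedWord ω n ∈ A} :=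
  measurableSet_of_prefix (n := n) fun ω ω' h hω => by
    simpa only [Set.mem_ofPred_eq, reducedWord_congr h] using hω

lemma wordProb_nonneg (p : unitInterval) (n : ℕ) (A : Set (ℕ × ℕ)) : 0 ≤ wordProb p n A :=
  measureReal_nonneg

lemma wordProb_le_one (p : unitInterval) (n : ℕ) (A : Set (ℕ × ℕ)) : wordProb p n A ≤ 1 :=
  measureReal_le_one

lemma wordProb_mono (p : unitInterval) (n : ℕ) {A B : Set (ℕ × ℕ)} (h : A ⊆ B) :
    wordProb p n A ≤ wordProb p n B :=
  measureReal_mono fun _ hω => h hω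

lemma wordProb_univ (p : unitInterval) (n : ℕ) : wordProb p n Set.univ = 1 := by
  simp [wordProb]

lemma wordProb_compl (p : unitInterval) (n : ℕ) (A : Set (ℕ × ℕ)) :
    wordProb p n Aᶜ = 1 - wordProb p n A :=
  probReal_compl_eq_one_sub (measurableSet_reducedWord n A)

lemma wordProb_zero (p : unitInterval) (A : Set (ℕ × ℕ)) [Decidable ((0, 0) ∈ A)] :
    wordProb p 0 A = if (0, 0) ∈ A then 1 else 0 := by
  by_cases h : (0, 0) ∈ A <;> simp [wordProb, reducedWord, h]

lemma wordProb_succ (p : unitInterval) (n : ℕ) (A : Set (ℕ × ℕ)) :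
    wordProb p (n + 1) A =
      p * wordProb p n {z | (if z.2 = 0 then (z.1 + 1, 0) else (z.1, z.2 - 1)) ∈ A} +
        (1 - p) * wordProb p n {z | (z.1, z.2 + 1) ∈ A} := by
  have key : ∀ (B : Set (ℕ × ℕ)) (c : Bool),
      (choiceLaw p).real ({ω | reducedWord ω n ∈ B} ∩ {ω | ω n = c}) =
        wordProb p n B * (if c = true then (p : ℝ) else 1 - p) := fun B c =>
    choiceLaw_real_inter_eval p n _ (fun ω ω' h hω => by
      simpa only [Set.mem_ofPred_eq, reducedWord_congr h] using hω) c
  have hset : {ω : ℕ → Bool | reducedWord ω (n + 1) ∈ A} =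
      ({ω | reducedWord ω n ∈ {z : ℕ × ℕ |
          (if z.2 = 0 then (z.1 + 1, 0) else (z.1, z.2 - 1)) ∈ A}} ∩ {ω | ω n = true}) ∪
        ({ω | reducedWord ω n ∈ {z : ℕ × ℕ | (z.1, z.2 + 1) ∈ A}} ∩ {ω | ω n = false}) := by
    ext ω
    cases h : ω n <;> simp [reducedWord, h]
  rw [wordProb, hset, measureReal_union, key, key]
  · simp only [if_true, Bool.false_eq_true, if_false]
    ring
  · rw [Set.disjoint_left]
    rintro ω ⟨-, h⟩ ⟨-, h'⟩
    simp_all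
  · exact (measurableSet_reducedWord n _).inter
      (measurableSet_eq_fun (measurable_pi_apply n) measurable_const)

/-! ### The surplus of contractions -/

/-- The probability that the reduced word after `n` steps contains at least `k` letters `g`. -/
noncomputable def surplusProb (p : unitInterval) (n k : ℕ) : ℝ := wordProb p n {z | k ≤ z.2}

lemma surplusProb_nonneg (p : unitInterval) (n k : ℕ) : 0 ≤ surplusProb p n k :=
  wordProb_nonneg _ _ _

lemma surplusProb_le_one (p : unitInterval) (n k : ℕ) : surplusProb p n k ≤ 1 :=
  wordProb_le_one _ _ _

lemma surplusProb_zero_right (p : unitInterval) (n : ℕ) : surplusProb p n 0 = 1 := by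
  simp [surplusProb, wordProb_univ]

lemma surplusProb_zero_succ (p : unitInterval) (k : ℕ) : surplusProb p 0 (k + 1) = 0 := by
  classical
  simp [surplusProb, wordProb_zero]

/-- At positive levels the reflection is invisible: a walk held at `0` reaches neither `k + 1` nor
`k + 2`. The boundary enters only through the value `1` at level `0`. -/
lemma surplusProb_succ_succ (p : unitInterval) (n k : ℕ) :
    surplusProb p (n + 1) (k + 1) =
      p * surplusProb p n (k + 2) + (1 - p) * surplusProb p n k := by
  rw [surplusProb, wordProb_succ]
  congr 3
  · ext ⟨a, b⟩
    simp only [Set.mem_ofPred_eq]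
    split_ifs <;> simp <;> omega
  · ext ⟨a, b⟩
    simp

lemma surplusProb_antitone (p : unitInterval) (n : ℕ) : Antitone (surplusProb p n) :=
  fun _ _ h => wordProb_mono p n fun _ hz => le_trans h hz

/-- The walk starts at its minimum and the recursion preserves order, so its law increases
stochastically. This gives convergence without any ergodic theorem. -/
lemma surplusProb_le_succ (p : unitInterval) (n k : ℕ) :
    surplusProb p n k ≤ surplusProb p (n + 1) k := by
  have hp := p.2.1
  have hq : (0 : ℝ) ≤ 1 - p := sub_nonneg.2 p.2.2
  induction n generalizing k with
  | zero =>
    cases k with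
    | zero => simp [surplusProb_zero_right]
    | succ k => rw [surplusProb_zero_succ]; exact surplusProb_nonneg _ _ _
  | succ n ih =>
    cases k with
    | zero => simp [surplusProb_zero_right]
    | succ k =>
      rw [surplusProb_succ_succ, surplusProb_succ_succ]
      have := ih (k + 2)
      have := ih k
      gcongr

/-- The limit of `surplusProb p n k` as `n` grows. -/
noncomputable def surplusLimit (p : unitInterval) (k : ℕ) : ℝ := ⨆ n, surplusProb p n k

lemma tendsto_surplusProb (p : unitInterval) (k : ℕ) :
    Tendsto (fun n => surplusProb p n k) atTop (𝓝 (surplusLimit p k)) :=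
  tendsto_atTop_ciSup (monotone_nat_of_le_succ fun n => surplusProb_le_succ p n k)
    ⟨1, by rintro _ ⟨n, rfl⟩; exact surplusProb_le_one _ _ _⟩

lemma surplusLimit_zero (p : unitInterval) : surplusLimit p 0 = 1 := by
  simp [surplusLimit, surplusProb_zero_right]

lemma surplusLimit_nonneg (p : unitInterval) (k : ℕ) : 0 ≤ surplusLimit p k :=
  Real.iSup_nonneg fun _ => surplusProb_nonneg _ _ _

lemma surplusLimit_antitone (p : unitInterval) : Antitone (surplusLimit p) := fun k l h =>
  le_of_tendsto_of_tendsto' (tendsto_surplusProb p l) (tendsto_surplusProb p k)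
    fun n => surplusProb_antitone p n h

lemma surplusLimit_succ (p : unitInterval) (k : ℕ) :
    surplusLimit p (k + 1) = p * surplusLimit p (k + 2) + (1 - p) * surplusLimit p k := by
  refine tendsto_nhds_unique ((tendsto_surplusProb p (k + 1)).comp (tendsto_add_atTop_nat 1)) ?_
  refine (((tendsto_surplusProb p (k + 2)).const_mul (p : ℝ)).add
    ((tendsto_surplusProb p k).const_mul (1 - (p : ℝ)))).congr fun n => ?_
  simp [surplusProb_succ_succ]

/-- The decrements satisfy `(1 - p) d k = p d (k + 1)`, so for `p ≤ 1/2` they are nonnegative and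
nondecreasing. Their sums telescope to at most `1`, which forces them to vanish. -/
lemma surplusLimit_eq_one (p : unitInterval) (hp : (p : ℝ) ≤ 1 / 2) (k : ℕ) :
    surplusLimit p k = 1 := by
  have hp0 := p.2.1
  set d : ℕ → ℝ := fun k => surplusLimit p k - surplusLimit p (k + 1) with hd
  have hd0 : ∀ k, 0 ≤ d k := fun k => sub_nonneg.2 (surplusLimit_antitone p k.le_succ)
  have hmono : Monotone d := by
    refine monotone_nat_of_le_succ fun k => ?_
    have h1 : (1 - (p : ℝ)) * d k = p * d (k + 1) := by
      have := surplusLimit_succ p k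
      simp only [hd, show k + 1 + 1 = k + 2 from rfl]
      linear_combination -this
    have h2 := hd0 (k + 1)
    by_contra! h
    nlinarith
  have hsum : ∀ k n : ℕ, n * d k ≤ 1 := by
    intro k n
    have h1 : ∑ i ∈ Finset.range n, d (k + i) = surplusLimit p k - surplusLimit p (k + n) := by
      have := Finset.sum_range_sub' (fun i => surplusLimit p (k + i)) n
      simpa [hd, add_assoc] using this
    have h2 : ∑ _i ∈ Finset.range n, d k ≤ ∑ i ∈ Finset.range n, d (k + i) :=
      Finset.sum_le_sum fun i _ => hmono (by omega)
    have h3 := surplusLimit_nonneg p (k + n)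
    have h4 := surplusLimit_antitone p k.zero_le
    rw [surplusLimit_zero] at h4
    simp only [Finset.sum_const, Finset.card_range, nsmul_eq_mul] at h2
    linarith
  have hzero : ∀ k, d k = 0 := by
    intro k
    refine le_antisymm ?_ (hd0 k)
    by_contra! h
    obtain ⟨n, hn⟩ := exists_nat_gt (1 / d k)
    rw [div_lt_iff₀ h] at hn
    linarith [hsum k n]
  induction k with
  | zero => exact surplusLimit_zero p
  | succ k ih => have := hzero k; simp only [hd] at this; linarith

/-- The sequence `r ^ k` is a stationary solution of the recursion and dominates the initial data.
-/
lemma surplusProb_le_pow (p : unitInterval) (hp : (1 / 2 : ℝ) < p) (n k : ℕ) :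
    surplusProb p n k ≤ ((1 - p) / p : ℝ) ^ k := by
  have hp0 : (0 : ℝ) < p := by linarith
  have hq : (0 : ℝ) ≤ 1 - p := sub_nonneg.2 p.2.2
  have hr : 0 ≤ (1 - p) / (p : ℝ) := by positivity
  induction n generalizing k with
  | zero =>
    cases k with
    | zero => simp [surplusProb_zero_right]
    | succ k => rw [surplusProb_zero_succ]; positivity
  | succ n ih =>
    cases k with
    | zero => simp [surplusProb_zero_right]
    | succ k =>
      rw [surplusProb_succ_succ]
      calc p * surplusProb p n (k + 2) + (1 - p) * surplusProb p n k
          ≤ p * ((1 - p) / p : ℝ) ^ (k + 2) + (1 - p) * ((1 - p) / p : ℝ) ^ k := by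
            have := ih (k + 2)
            have := ih k
            gcongr
        _ = ((1 - p) / p : ℝ) ^ (k + 1) := by
            rw [pow_add, pow_succ _ k]
            field_simp
            ring

/-- The recurrence for the limit has characteristic roots `1` and `r`; decay to `0` excludes the
root `1`. -/
lemma surplusLimit_eq_pow (p : unitInterval) (hp : (1 / 2 : ℝ) < p) (k : ℕ) :
    surplusLimit p k = ((1 - p) / p : ℝ) ^ k := by
  have hp0 : (0 : ℝ) < p := by linarith
  have hq : (0 : ℝ) ≤ 1 - p := sub_nonneg.2 p.2.2
  set r : ℝ := (1 - p) / p with hr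
  have hr0 : 0 ≤ r := by positivity
  have hr1 : r < 1 := by rw [hr, div_lt_one hp0]; linarith
  have hqr : 1 - (p : ℝ) = p * r := by rw [hr]; field_simp
  -- `surplusLimit p k - r ^ k` has geometric increments, tends to zero and starts at zero.
  set e : ℕ → ℝ := fun k => surplusLimit p (k + 1) - r * surplusLimit p k with he
  have hstep : ∀ k, e (k + 1) = e k := by
    intro k
    have h := surplusLimit_succ p k
    rw [hqr] at h
    have hpr : (p : ℝ) * (1 + r) = 1 := by linarith
    have : (p : ℝ) * (e (k + 1) - e k) = 0 := by
      simp only [he, show k + 1 + 1 = k + 2 from rfl]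
      linear_combination -h - surplusLimit p (k + 1) * hpr
    have := (mul_eq_zero.1 this).resolve_left hp0.ne'
    linarith
  have hconst : ∀ k, e k = e 0 := fun k => by
    induction k with
    | zero => rfl
    | succ k ih => rw [hstep, ih]
  have hlim : Tendsto (surplusLimit p) atTop (𝓝 0) :=
    squeeze_zero (surplusLimit_nonneg p)
      (fun k => le_of_tendsto' (tendsto_surplusProb p k) fun n => surplusProb_le_pow p hp n k)
      (tendsto_pow_atTop_nhds_zero_of_lt_one hr0 hr1)
  have he0 : e 0 = 0 := by
    have h1 : Tendsto e atTop (𝓝 0) := by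
      simpa using (hlim.comp (tendsto_add_atTop_nat 1)).sub (hlim.const_mul r)
    exact tendsto_nhds_unique (tendsto_const_nhds.congr fun k => (hconst k).symm) h1
  induction k with
  | zero => simp [surplusLimit_zero]
  | succ k ih =>
    have := (hconst k).trans he0
    simp only [he] at this
    rw [pow_succ, ← ih]
    linarith

/-! ### The expanding part of the reduced word grows -/

/-- A Chernoff bound: every `f` raises `a - b` by one, whether it cancels a `g` or not, and every
`g` lowers it by one. So `a - b` is a free walk with `E s^(a - b) = (p s + (1 - p) / s) ^ n`. The
induction shifts `k` both ways, hence integer levels. -/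
lemma wordProb_drift_le (p : unitInterval) (s : ℝ) (hs0 : 0 < s) (hs1 : s < 1) (n : ℕ) (k : ℤ) :
    wordProb p n {z | (z.1 : ℤ) - z.2 ≤ k} ≤ (p * s + (1 - p) / s) ^ n * s ^ (-k) := by
  have hp0 := p.2.1
  have hq : (0 : ℝ) ≤ 1 - p := sub_nonneg.2 p.2.2
  induction n generalizing k with
  | zero =>
    classical
    rw [wordProb_zero]
    simp only [Set.mem_ofPred_eq, Nat.cast_zero, sub_zero, pow_zero, one_mul]
    split_ifs with h
    · rw [zpow_neg, ← inv_zpow]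
      exact one_le_zpow₀ (one_le_inv₀ hs0 |>.2 hs1.le) h
    · positivity
  | succ n ih =>
    rw [wordProb_succ]
    have h1 : {z : ℕ × ℕ | (if z.2 = 0 then (z.1 + 1, 0) else (z.1, z.2 - 1)) ∈
        {z : ℕ × ℕ | (z.1 : ℤ) - z.2 ≤ k}} = {z : ℕ × ℕ | (z.1 : ℤ) - z.2 ≤ k - 1} := by
      ext ⟨a, b⟩
      simp only [Set.mem_ofPred_eq]
      split_ifs with h
      · simp [h]
      · omega
    have h2 : {z : ℕ × ℕ | (z.1, z.2 + 1) ∈ {z : ℕ × ℕ | (z.1 : ℤ) - z.2 ≤ k}} =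
        {z : ℕ × ℕ | (z.1 : ℤ) - z.2 ≤ k + 1} := by
      ext ⟨a, b⟩
      simp only [Set.mem_ofPred_eq]
      push_cast
      omega
    rw [h1, h2]
    calc _ ≤ p * ((p * s + (1 - p) / s) ^ n * s ^ (-(k - 1))) +
          (1 - p) * ((p * s + (1 - p) / s) ^ n * s ^ (-(k + 1))) := by
            have := ih (k - 1)
            have := ih (k + 1)
            gcongr
      _ = _ := by
            have e1 : s ^ (-(k - 1)) = s ^ (-k) * s := by
              rw [← zpow_add_one₀ hs0.ne']; congr 1; ring
            have e2 : s ^ (-(k + 1)) = s ^ (-k) / s := by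
              rw [div_eq_mul_inv, ← zpow_sub_one₀ hs0.ne']; congr 1; ring
            rw [e1, e2]
            ring

lemma tendsto_wordProb_fst_lt (p : unitInterval) (hp : (1 / 2 : ℝ) < p) (M : ℕ) :
    Tendsto (fun n => wordProb p n {z | z.1 < M}) atTop (𝓝 0) := by
  have hp0 : (0 : ℝ) < p := by linarith
  have hq : (0 : ℝ) ≤ 1 - p := sub_nonneg.2 p.2.2
  set r : ℝ := (1 - p) / p with hr
  have hr0 : 0 ≤ r := by positivity
  have hr1 : r < 1 := by rw [hr, div_lt_one hp0]; linarith
  have hqr : 1 - (p : ℝ) = p * r := by rw [hr]; field_simp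
  -- `p s + (1 - p) / s < 1` holds exactly for `s` strictly between the roots `r` and `1` of `p s² -
  -- s + (1 - p)`; the midpoint is taken.
  set s : ℝ := (1 + r) / 2 with hs
  have hs0 : 0 < s := by positivity
  have hs1 : s < 1 := by rw [hs]; linarith
  have hρ0 : 0 ≤ p * s + (1 - p) / s := by positivity
  have hρ1 : p * s + (1 - p) / s < 1 := by
    have : p * s + (1 - p) / s - 1 = -(p * ((1 - s) * (s - r))) / s := by
      have hpr : (p : ℝ) * (1 + r) = 1 := by linarith
      rw [hqr]
      clear_value s r
      field_simp
      linear_combination s * hpr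
    have h2 : 0 < p * ((1 - s) * (s - r)) / s := by
      have : 0 < 1 - s := by linarith
      have : 0 < s - r := by rw [hs]; linarith
      positivity
    rw [neg_div] at this
    linarith
  have hlim : Tendsto (fun n => (p * s + (1 - p) / s) ^ n * s ^ (-(M : ℤ))) atTop (𝓝 0) := by
    simpa using (tendsto_pow_atTop_nhds_zero_of_lt_one hρ0 hρ1).mul_const (s ^ (-(M : ℤ)))
  refine squeeze_zero (fun n => wordProb_nonneg _ _ _) (fun n => ?_) hlim
  refine (wordProb_mono p n fun z hz => ?_).trans (wordProb_drift_le p s hs0 hs1 n M)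
  simp only [Set.mem_ofPred_eq] at hz ⊢
  omega

/-! ### The system of the zigzag map and the contraction -/

lemma coe_zigzag_of_le {x : Set.Icc (0 : ℝ) 1} (h : (x : ℝ) ≤ 1 / 3) :
    (zigzag x : ℝ) = 3 * x :=
  if_pos h

lemma coe_zigzag_of_ge {x : Set.Icc (0 : ℝ) 1} (h : 2 / 3 ≤ (x : ℝ)) :
    (zigzag x : ℝ) = 3 * x - 2 :=
  (if_neg (by linarith)).trans (if_neg (by linarith))

lemma coe_third (x : Set.Icc (0 : ℝ) 1) : (third x : ℝ) = 1 / 3 * x := rfl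

lemma zigzag_third : Function.LeftInverse zigzag third := by
  intro x
  have h1 := x.2.2
  apply Subtype.ext
  rw [coe_zigzag_of_le (by rw [coe_third]; linarith), coe_third]
  ring

lemma coe_third_iterate (b : ℕ) (x : Set.Icc (0 : ℝ) 1) :
    ((third^[b] x : Set.Icc (0 : ℝ) 1) : ℝ) = (1 / 3) ^ b * x := by
  induction b with
  | zero => simp
  | succ b ih => rw [Function.iterate_succ_apply', pow_succ', mul_assoc, ← ih, coe_third]

lemma abs_trajectory_sub (ω : ℕ → Bool) (x y : Set.Icc (0 : ℝ) 1) (n : ℕ) :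
    |(trajectory zigzag third ω x n : ℝ) - trajectory zigzag third ω y n| =
      (1 / 3) ^ (reducedWord ω n).2 *
        |(zigzag^[(reducedWord ω n).1] x : ℝ) - zigzag^[(reducedWord ω n).1] y| := by
  rw [trajectory_eq_iterate zigzag_third, trajectory_eq_iterate zigzag_third, coe_third_iterate,
    coe_third_iterate, ← mul_sub, abs_mul, abs_of_nonneg (by positivity)]

lemma abs_trajectory_sub_le (ω : ℕ → Bool) (x y : Set.Icc (0 : ℝ) 1) (n : ℕ) :
    |(trajectory zigzag third ω x n : ℝ) - trajectory zigzag third ω y n| ≤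
      (1 / 3) ^ (reducedWord ω n).2 := by
  rw [abs_trajectory_sub]
  refine mul_le_of_le_one_right (by positivity) ?_
  set u := zigzag^[(reducedWord ω n).1] x
  set v := zigzag^[(reducedWord ω n).1] y
  rw [abs_le]
  constructor <;> linarith [u.2.1, u.2.2, v.2.1, v.2.2]

lemma surplusLimit_le_lowerDistFun (p : unitInterval) (x y : Set.Icc (0 : ℝ) 1) {t : ℝ} {m : ℕ}
    (ht : (1 / 3 : ℝ) ^ m < t) : surplusLimit p m ≤ lowerDistFun zigzag third p x y t := by
  have hlim := (tendsto_surplusProb p m).cesaro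
  rw [← hlim.liminf_eq]
  refine liminf_le_liminf (Eventually.of_forall fun n => ?_) hlim.isBoundedUnder_ge
    (distFun_bddAbove zigzag third p x y t).isCoboundedUnder_ge
  rw [distFun, one_div]
  refine mul_le_mul_of_nonneg_left (Finset.sum_le_sum fun i _ => ?_) (by positivity)
  refine measureReal_mono fun ω hω => ?_
  refine (abs_trajectory_sub_le ω x y i).trans_lt (lt_of_le_of_lt ?_ ht)
  exact pow_le_pow_of_le_one (by norm_num) (by norm_num) hω

section

variable {a b : ℝ} (f g : Set.Icc a b → Set.Icc a b)

lemma lowerDistFun_le_upperDistFun (p : unitInterval) (x y : Set.Icc a b) (t : ℝ) :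
    lowerDistFun f g p x y t ≤ upperDistFun f g p x y t :=
  liminf_le_limsup (distFun_bddAbove f g p x y t) (distFun_bddBelow f g p x y t)

lemma distArea_nonneg (hab : a ≤ b) (p : unitInterval) (x y : Set.Icc a b) :
    0 ≤ distArea f g p x y :=
  intervalIntegral.integral_nonneg (sub_nonneg.2 hab) fun t _ =>
    sub_nonneg.2 (lowerDistFun_le_upperDistFun f g p x y t)

end

/-! ### The extremal lower distribution function -/

/-- For `0 < t ≤ 1` this is `r ^ m`, where `m` is the least number with `3⁻ᵐ < t`. -/
noncomputable def scalePow (r t : ℝ) : ℝ := r ^ (⌊Real.logb 3 t⁻¹⌋₊ + 1)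

lemma pow_floor_logb_succ_lt {t : ℝ} (ht : 0 < t) :
    (1 / 3 : ℝ) ^ (⌊Real.logb 3 t⁻¹⌋₊ + 1) < t := by
  have h := Nat.lt_floor_add_one (Real.logb 3 t⁻¹)
  rw [Real.logb_lt_iff_lt_rpow (by norm_num) (by positivity)] at h
  rw [one_div, inv_pow, inv_lt_comm₀ (by positivity) ht]
  exact_mod_cast h

lemma le_pow_floor_logb {t : ℝ} (ht : 0 < t) (ht1 : t ≤ 1) :
    t ≤ (1 / 3 : ℝ) ^ ⌊Real.logb 3 t⁻¹⌋₊ := by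
  have h := Nat.floor_le (Real.logb_nonneg (by norm_num : (1 : ℝ) < 3) ((one_le_inv₀ ht).2 ht1))
  rw [Real.le_logb_iff_rpow_le (by norm_num) (by positivity)] at h
  rw [one_div, inv_pow, le_inv_comm₀ ht (by positivity)]
  exact_mod_cast h

/-- For `t ≤ 1` the logarithm is nonnegative, so the truncated floor commutes with adding one. -/
lemma scalePow_div_three (r : ℝ) {t : ℝ} (ht : 0 < t) (ht1 : t ≤ 1) :
    scalePow r (t / 3) = r * scalePow r t := by
  have h : Real.logb 3 (t / 3)⁻¹ = Real.logb 3 t⁻¹ + 1 := by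
    rw [inv_div, div_eq_mul_inv, Real.logb_mul (by norm_num) (by positivity),
      Real.logb_self_eq_one (by norm_num), add_comm]
  rw [scalePow, scalePow, h, Nat.floor_add_one
    (Real.logb_nonneg (by norm_num) ((one_le_inv₀ ht).2 ht1)), pow_succ']

lemma scalePow_of_third_lt (r : ℝ) {t : ℝ} (ht : 1 / 3 < t) : scalePow r t = r := by
  have ht0 : 0 < t := by linarith
  have h : ⌊Real.logb 3 t⁻¹⌋₊ = 0 := by
    rw [Nat.floor_eq_zero, Real.logb_lt_iff_lt_rpow (by norm_num) (by positivity), Real.rpow_one]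
    rw [inv_lt_comm₀ ht0 (by norm_num)]
    linarith
  rw [scalePow, h, zero_add, pow_one]

lemma intervalIntegrable_scalePow {r : ℝ} (hr0 : 0 ≤ r) (hr1 : r ≤ 1) (c d : ℝ) :
    IntervalIntegrable (scalePow r) volume c d := by
  have hm : Measurable (scalePow r) := by
    have h1 : Measurable fun t : ℝ => Real.logb 3 t⁻¹ :=
      (Real.measurable_log.comp measurable_inv).div_const _
    exact (measurable_from_top (f := fun n : ℕ => r ^ (n + 1))).comp
      (Nat.measurable_floor.comp h1)
  refine (intervalIntegrable_const (c := (1 : ℝ))).mono_fun hm.aestronglyMeasurable ?_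
  refine Eventually.of_forall fun t => ?_
  simp only [scalePow, Real.norm_eq_abs, abs_one]
  rw [abs_of_nonneg (by positivity)]
  exact pow_le_one₀ hr0 hr1

/-- Self-similarity under `t ↦ t / 3` gives `I = (2 / 3) r + (r / 3) I`. -/
lemma integral_scalePow {r : ℝ} (hr0 : 0 ≤ r) (hr1 : r ≤ 1) :
    ∫ t in (0 : ℝ)..1, scalePow r t = 2 * r / (3 - r) := by
  have hint := intervalIntegrable_scalePow hr0 hr1
  have h1 : ∫ t in (1 / 3 : ℝ)..1, scalePow r t = 2 / 3 * r := by
    have : ∫ t in (1 / 3 : ℝ)..1, scalePow r t = ∫ _t in (1 / 3 : ℝ)..1, r := by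
      refine intervalIntegral.integral_congr_ae (Eventually.of_forall fun t ht => ?_)
      rw [Set.uIoc_of_le (by norm_num)] at ht
      exact scalePow_of_third_lt r ht.1
    rw [this, intervalIntegral.integral_const, smul_eq_mul]
    norm_num
  have h2 : ∫ t in (0 : ℝ)..(1 / 3), scalePow r t = r / 3 * ∫ t in (0 : ℝ)..1, scalePow r t := by
    have e1 := intervalIntegral.integral_comp_div (a := 0) (b := 1) (scalePow r)
      (three_ne_zero (α := ℝ))
    have e2 : ∫ t in (0 : ℝ)..1, scalePow r (t / 3) = ∫ t in (0 : ℝ)..1, r * scalePow r t := by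
      refine intervalIntegral.integral_congr_ae (Eventually.of_forall fun t ht => ?_)
      rw [Set.uIoc_of_le zero_le_one] at ht
      exact scalePow_div_three r ht.1 ht.2
    rw [e2, intervalIntegral.integral_const_mul, zero_div, smul_eq_mul] at e1
    linarith
  have h3 := intervalIntegral.integral_add_adjacent_intervals (hint 0 (1 / 3)) (hint (1 / 3) 1)
  rw [h1, h2] at h3
  rw [eq_div_iff (by linarith)]
  linarith

lemma integral_one_sub_scalePow (p : unitInterval) (hp : (1 / 2 : ℝ) < p) :
    ∫ t in (0 : ℝ)..1, (1 - scalePow ((1 - p) / p) t) = (6 * (p : ℝ) - 3) / (4 * (p : ℝ) - 1) := by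
  have hp0 : (0 : ℝ) < p := by linarith
  have hq : (0 : ℝ) ≤ 1 - p := sub_nonneg.2 p.2.2
  have hr0 : 0 ≤ (1 - p) / (p : ℝ) := by positivity
  have hr1 : (1 - p) / (p : ℝ) ≤ 1 := by rw [div_le_one hp0]; linarith
  rw [intervalIntegral.integral_sub intervalIntegrable_const
    (intervalIntegrable_scalePow hr0 hr1 0 1), integral_scalePow hr0 hr1]
  have h3 : 3 - (1 - p) / (p : ℝ) = (4 * p - 1) / p := by field_simp; ring
  have h4 : 4 * (p : ℝ) - 1 ≠ 0 := by linarith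
  rw [h3, intervalIntegral.integral_const]
  rw [smul_eq_mul, div_div_eq_mul_div, eq_div_iff h4, sub_mul, div_mul_cancel₀ _ h4, mul_assoc 2,
    div_mul_cancel₀ _ hp0.ne']
  ring

lemma distArea_zigzag_third_le (p : unitInterval) (hp : (1 / 2 : ℝ) < p)
    (x y : Set.Icc (0 : ℝ) 1) :
    distArea zigzag third p x y ≤ (6 * (p : ℝ) - 3) / (4 * (p : ℝ) - 1) := by
  have hp0 : (0 : ℝ) < p := by linarith
  have hq : (0 : ℝ) ≤ 1 - p := sub_nonneg.2 p.2.2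
  have hr1 : (1 - p) / (p : ℝ) ≤ 1 := by rw [div_le_one hp0]; linarith
  rw [← integral_one_sub_scalePow p hp, distArea, sub_zero]
  refine intervalIntegral.integral_mono_on_of_le_Ioo zero_le_one
    (intervalIntegrable_upper_sub_lower zigzag third p x y 0 1)
    (intervalIntegrable_const.sub (intervalIntegrable_scalePow (by positivity) hr1 0 1))
    fun t ht => ?_
  have h1 := surplusLimit_le_lowerDistFun p x y (pow_floor_logb_succ_lt ht.1)
  rw [surplusLimit_eq_pow p hp] at h1
  have h2 := upperDistFun_le_one zigzag third p x y t
  rw [scalePow]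
  linarith

lemma distArea_zigzag_third_eq_zero (p : unitInterval) (hp : (p : ℝ) ≤ 1 / 2)
    (x y : Set.Icc (0 : ℝ) 1) : distArea zigzag third p x y = 0 := by
  refine le_antisymm ?_ (distArea_nonneg _ _ zero_le_one p x y)
  have h : ∫ _t in (0 : ℝ)..1, (0 : ℝ) = 0 := by simp
  rw [distArea, sub_zero]
  refine le_of_le_of_eq ?_ h
  refine intervalIntegral.integral_mono_on_of_le_Ioo zero_le_one
    (intervalIntegrable_upper_sub_lower zigzag third p x y 0 1) intervalIntegrable_const
    fun t ht => ?_
  have h1 := surplusLimit_le_lowerDistFun p x y (pow_floor_logb_succ_lt ht.1)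
  rw [surplusLimit_eq_one p hp] at h1
  have h2 := upperDistFun_le_one zigzag third p x y t
  linarith

/-! ### Points of the Cantor set with prescribed itineraries -/

/-- The number whose ternary digits are `2` where `s` holds from the index `k` on, and `0`
elsewhere. -/
noncomputable def cantorValue (s : ℕ → Bool) (k : ℕ) : ℝ :=
  ∑' j : ℕ, (if s (k + j) = true then 2 / 3 else 0) * (1 / 3 : ℝ) ^ j

lemma summable_cantorValue (s : ℕ → Bool) (k : ℕ) :
    Summable fun j : ℕ => (if s (k + j) = true then 2 / 3 else 0) * (1 / 3 : ℝ) ^ j := by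
  refine Summable.of_nonneg_of_le (fun j => ?_) (fun j => ?_)
    ((summable_geometric_of_lt_one (by norm_num) (by norm_num : (1 / 3 : ℝ) < 1)).mul_left (2 / 3))
  · split_ifs <;> positivity
  · refine mul_le_mul_of_nonneg_right ?_ (by positivity)
    split_ifs <;> norm_num

lemma cantorValue_eq (s : ℕ → Bool) (k : ℕ) :
    cantorValue s k = (if s k = true then 2 / 3 else 0) + cantorValue s (k + 1) / 3 := by
  rw [cantorValue, (summable_cantorValue s k).tsum_eq_zero_add, cantorValue, ← tsum_div_const]
  congr 1
  · simp
  · refine tsum_congr fun j => ?_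
    rw [show k + 1 + j = k + (j + 1) by ring, pow_succ]
    ring

lemma cantorValue_nonneg (s : ℕ → Bool) (k : ℕ) : 0 ≤ cantorValue s k :=
  tsum_nonneg fun j => by split_ifs <;> positivity

lemma cantorValue_le_one (s : ℕ → Bool) (k : ℕ) : cantorValue s k ≤ 1 := by
  have h := (summable_cantorValue s k).tsum_le_tsum (fun j => ?_)
    ((summable_geometric_of_lt_one (by norm_num) (by norm_num : (1 / 3 : ℝ) < 1)).mul_left (2 / 3))
  · rw [tsum_mul_left, tsum_geometric_of_lt_one (by norm_num) (by norm_num)] at h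
    refine h.trans (by norm_num)
  · refine mul_le_mul_of_nonneg_right ?_ (by positivity)
    split_ifs <;> norm_num

/-- The point of the unit interval given by `cantorValue`. -/
noncomputable def cantorPoint (s : ℕ → Bool) (k : ℕ) : Set.Icc (0 : ℝ) 1 :=
  ⟨cantorValue s k, cantorValue_nonneg s k, cantorValue_le_one s k⟩

/-- Ternary digits `0` and `2` meet only the two increasing branches, on which `zigzag` is the digit
shift. -/
lemma zigzag_cantorPoint (s : ℕ → Bool) (k : ℕ) :
    zigzag (cantorPoint s k) = cantorPoint s (k + 1) := by
  apply Subtype.ext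
  have h0 := cantorValue_nonneg s (k + 1)
  have h1 := cantorValue_le_one s (k + 1)
  have h := cantorValue_eq s k
  have hc : ∀ k, (cantorPoint s k : ℝ) = cantorValue s k := fun _ => rfl
  split_ifs at h with hs
  · rw [coe_zigzag_of_ge (by rw [hc]; linarith), hc, hc, h]
    ring
  · rw [coe_zigzag_of_le (by rw [hc]; linarith), hc, hc, h]
    ring

lemma zigzag_iterate_cantorPoint (s : ℕ → Bool) (k : ℕ) :
    zigzag^[k] (cantorPoint s 0) = cantorPoint s k := by
  induction k with
  | zero => rfl
  | succ k ih => rw [Function.iterate_succ_apply', ih, zigzag_cantorPoint]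

lemma cantorValue_le_pow (s : ℕ → Bool) (k L : ℕ) (h : ∀ j < L, s (k + j) = false) :
    cantorValue s k ≤ (1 / 3) ^ L := by
  induction L generalizing k with
  | zero => simpa using cantorValue_le_one s k
  | succ L ih =>
    have h0 := h 0 (by omega)
    have h1 := ih (k + 1) fun j hj => by
      rw [show k + 1 + j = k + (j + 1) by ring]; exact h _ (by omega)
    rw [cantorValue_eq, pow_succ]
    simp only [add_zero] at h0
    simp only [h0, Bool.false_eq_true, if_false]
    linarith

lemma one_sub_pow_le_cantorValue (s : ℕ → Bool) (k L : ℕ) (h : ∀ j < L, s (k + j) = true) :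
    1 - (1 / 3) ^ L ≤ cantorValue s k := by
  induction L generalizing k with
  | zero => simpa using cantorValue_nonneg s k
  | succ L ih =>
    have h0 := h 0 (by omega)
    have h1 := ih (k + 1) fun j hj => by
      rw [show k + 1 + j = k + (j + 1) by ring]; exact h _ (by omega)
    rw [cantorValue_eq, pow_succ]
    simp only [add_zero] at h0
    simp only [h0, if_true]
    linarith

/-- A point whose orbit under the zigzag map stays alternately near `0` and near `1` during
prescribed blocks of times. -/
lemma exists_zigzag_orbit_alternating (M : ℕ → ℕ) (hM : StrictMono M) :
    ∃ x : Set.Icc (0 : ℝ) 1, ∀ j k, M j ≤ k → k + j ≤ M (j + 1) →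
      (Even j → (zigzag^[k] x : ℝ) ≤ (1 / 3) ^ j) ∧
      (Odd j → 1 - (1 / 3) ^ j ≤ (zigzag^[k] x : ℝ)) := by
  classical
  -- The digit is `2` exactly on the odd blocks. The condition `k + j ≤ M (j + 1)` keeps the next
  -- `j` digits inside the block, which places the orbit within `3⁻ʲ` of `0` or `1`.
  set s : ℕ → Bool := fun k => decide (∃ j, Odd j ∧ M j ≤ k ∧ k < M (j + 1)) with hs
  have huniq : ∀ i j k, M i ≤ k → k < M (i + 1) → M j ≤ k → k < M (j + 1) → i = j := by
    intro i j k h1 h2 h3 h4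
    have h5 : i < j + 1 := hM.lt_iff_lt.1 (h1.trans_lt h4)
    have h6 : j < i + 1 := hM.lt_iff_lt.1 (h3.trans_lt h2)
    omega
  refine ⟨cantorPoint s 0, fun j k h1 h2 => ⟨fun hj => ?_, fun hj => ?_⟩⟩
  · rw [zigzag_iterate_cantorPoint]
    refine cantorValue_le_pow s k j fun l hl => ?_
    simp only [hs, decide_eq_false_iff_not]
    rintro ⟨i, hi, h3, h4⟩
    obtain rfl := huniq i j (k + l) h3 h4 (by omega) (by omega)
    exact (Nat.not_even_iff_odd.2 hi) hj
  · rw [zigzag_iterate_cantorPoint]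
    refine one_sub_pow_le_cantorValue s k j fun l hl => ?_
    simp only [hs, decide_eq_true_eq]
    exact ⟨j, hj, by omega, by omega⟩

/-! ### The extremal pair -/

lemma zigzag_iterate_zero (k : ℕ) : zigzag^[k] 0 = 0 :=
  Function.iterate_fixed (Subtype.ext (by rw [coe_zigzag_of_le (by simp)]; simp)) k

lemma exists_average_wordProb_lt (p : unitInterval) (hp : (1 / 2 : ℝ) < p) (j M : ℕ) :
    ∃ n, M < n ∧ (1 / (n : ℝ)) * ∑ i ∈ Finset.range n, wordProb p i {z | z.1 < M} <
      1 / ((j : ℝ) + 1) := by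
  have h := (tendsto_wordProb_fst_lt p hp M).cesaro
  have h1 := h.eventually_lt_const (Nat.one_div_pos_of_nat (α := ℝ) (n := j))
  obtain ⟨n, h2, h3⟩ := (h1.and (eventually_gt_atTop M)).exists
  exact ⟨n, h3, by rwa [one_div (n : ℝ)]⟩

/-- Before time `n` one has `a < n`, so outside the event `a < M` the orbit of `x` is sampled only
where it is within `δ` of `0`; the factor `3⁻ᵇ` can only help. -/
lemma one_sub_le_distFun_of_near_zero (p : unitInterval) (x : Set.Icc (0 : ℝ) 1) {n M : ℕ}
    {δ t : ℝ} (hn : 0 < n) (hx : ∀ k, M ≤ k → k < n → (zigzag^[k] x : ℝ) ≤ δ) (ht : δ < t) :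
    1 - (1 / (n : ℝ)) * ∑ i ∈ Finset.range n, wordProb p i {z | z.1 < M} ≤
      distFun zigzag third p x 0 n t := by
  have hn' : (n : ℝ) ≠ 0 := by positivity
  have h1 : 1 - (1 / (n : ℝ)) * ∑ i ∈ Finset.range n, wordProb p i {z | z.1 < M} =
      (1 / (n : ℝ)) * ∑ i ∈ Finset.range n, wordProb p i {z | z.1 < M}ᶜ := by
    simp only [wordProb_compl, Finset.sum_sub_distrib, mul_sub]
    simp [hn']
  rw [h1, distFun]
  refine mul_le_mul_of_nonneg_left (Finset.sum_le_sum fun i hi => ?_) (by positivity)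
  refine measureReal_mono fun ω hω => ?_
  simp only [Set.mem_compl_iff, Set.mem_ofPred_eq, not_lt] at hω ⊢
  rw [abs_trajectory_sub, zigzag_iterate_zero]
  have h2 := hx _ hω ((reducedWord_fst_le ω i).trans_lt (Finset.mem_range.1 hi))
  have h3 := (zigzag^[(reducedWord ω i).1] x).2.1
  simp only [Set.Icc.coe_zero, sub_zero]
  rw [abs_of_nonneg h3]
  refine lt_of_le_of_lt ?_ (h2.trans_lt ht)
  exact mul_le_of_le_one_left h3 (pow_le_one₀ (by norm_num) (by norm_num))

/-- If `a ≥ M` and `b ≤ m`, the distance is at least `3⁻ᵐ δ ≥ t`. A smaller distance thus needs `a <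
M` or `b ≥ m + 1`, and the latter has probability at most `r ^ (m + 1)` uniformly in time. -/
lemma distFun_le_of_near_one (p : unitInterval) (hp : (1 / 2 : ℝ) < p) (x : Set.Icc (0 : ℝ) 1)
    {n M m : ℕ} {δ t : ℝ} (hx : ∀ k, M ≤ k → k < n → δ ≤ (zigzag^[k] x : ℝ))
    (ht : t ≤ (1 / 3) ^ m * δ) (hδ : 0 ≤ δ) :
    distFun zigzag third p x 0 n t ≤
      (1 / (n : ℝ)) * ∑ i ∈ Finset.range n, wordProb p i {z | z.1 < M} +
        ((1 - p) / p : ℝ) ^ (m + 1) := by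
  have hp0 : (0 : ℝ) < p := by linarith
  have hq : (0 : ℝ) ≤ 1 - p := sub_nonneg.2 p.2.2
  have hterm : ∀ i ∈ Finset.range n, (choiceLaw p).real
      {ω | |(trajectory zigzag third ω x i : ℝ) - trajectory zigzag third ω 0 i| < t} ≤
        wordProb p i {z | z.1 < M} + ((1 - p) / p : ℝ) ^ (m + 1) := by
    intro i hi
    refine (measureReal_mono fun ω hω => ?_).trans ((measureReal_union_le
      {ω | reducedWord ω i ∈ {z : ℕ × ℕ | z.1 < M}}
      {ω | reducedWord ω i ∈ {z : ℕ × ℕ | m + 1 ≤ z.2}}).trans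
        (add_le_add_right (surplusProb_le_pow p hp i (m + 1)) _))
    by_contra hcon
    simp only [Set.mem_union, Set.mem_ofPred_eq, not_or, not_lt, not_le] at hcon hω
    rw [abs_trajectory_sub, zigzag_iterate_zero] at hω
    have h2 := hx _ hcon.1 ((reducedWord_fst_le ω i).trans_lt (Finset.mem_range.1 hi))
    simp only [Set.Icc.coe_zero, sub_zero] at hω
    rw [abs_of_nonneg (hδ.trans h2)] at hω
    have h3 : (1 / 3 : ℝ) ^ m ≤ (1 / 3) ^ (reducedWord ω i).2 :=
      pow_le_pow_of_le_one (by norm_num) (by norm_num) (by omega)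
    have h4 := mul_le_mul h3 h2 hδ (by positivity)
    linarith
  rw [distFun]
  rcases Nat.eq_zero_or_pos n with rfl | hn
  · simp; positivity
  · have hn' : (n : ℝ) ≠ 0 := by positivity
    refine (mul_le_mul_of_nonneg_left (Finset.sum_le_sum hterm) (by positivity)).trans_eq ?_
    rw [Finset.sum_add_distrib, mul_add]
    simp [hn']

lemma exists_extremal_point (p : unitInterval) (hp : (1 / 2 : ℝ) < p) :
    ∃ x : Set.Icc (0 : ℝ) 1,
      (∀ t, 0 < t → 1 ≤ upperDistFun zigzag third p x 0 t) ∧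
      ∀ t m, t < (1 / 3 : ℝ) ^ m →
        lowerDistFun zigzag third p x 0 t ≤ ((1 - p) / p : ℝ) ^ (m + 1) := by
  choose N hNM hN using exists_average_wordProb_lt p hp
  -- Block `j` lasts until the average probability of `a < M j` is below `1 / (j + 1)`; the extra
  -- `j` is the margin required by `exists_zigzag_orbit_alternating`.
  let M : ℕ → ℕ := fun j => Nat.rec 0 (fun j m => N j m + j) j
  have hMs : ∀ j, M (j + 1) = N j (M j) + j := fun j => rfl
  have hM : StrictMono M := strictMono_nat_of_lt_succ fun j => by
    rw [hMs]
    have := hNM j (M j)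
    omega
  obtain ⟨x, hx⟩ := exists_zigzag_orbit_alternating M hM
  have hNj : ∀ j, j < N j (M j) := fun j => (hM.id_le j).trans_lt (hNM j (M j))
  have hpow : Tendsto (fun j : ℕ => (1 / 3 : ℝ) ^ j) atTop (𝓝 0) :=
    tendsto_pow_atTop_nhds_zero_of_lt_one (by norm_num) (by norm_num)
  have hinv := tendsto_one_div_add_atTop_nhds_zero_nat (𝕜 := ℝ)
  refine ⟨x, fun t ht => ?_, fun t m ht => ?_⟩
  · refine le_of_forall_sub_le fun ε hε => ?_
    refine le_limsup_of_frequently_le ?_ (distFun_bddAbove zigzag third p x 0 t)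
    rw [frequently_atTop]
    intro n₀
    obtain ⟨j₀, hj₀⟩ := eventually_atTop.1
      ((hpow.eventually_lt_const ht).and (hinv.eventually_lt_const hε))
    -- Even blocks lie near `0`; this index also exceeds both thresholds, and `N j (M j) > j` makes
    -- the time late enough.
    set j := 2 * (j₀ + n₀) with hj
    obtain ⟨h1, h2⟩ := hj₀ j (by omega)
    have hlt := hNj j
    refine ⟨N j (M j), by omega, ?_⟩
    have h3 := one_sub_le_distFun_of_near_zero p x (n := N j (M j)) (M := M j) (by omega)
      (fun k hk hk' => (hx j k hk (by rw [hMs]; omega)).1 (even_two_mul _)) h1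
    have h4 := hN j (M j)
    linarith
  · refine le_of_forall_pos_le_add fun ε hε => ?_
    refine liminf_le_of_frequently_le ?_ (distFun_bddBelow zigzag third p x 0 t)
    rw [frequently_atTop]
    intro n₀
    have hlim : Tendsto (fun j : ℕ => (1 / 3 : ℝ) ^ m * (1 - (1 / 3) ^ j)) atTop
        (𝓝 ((1 / 3) ^ m)) := by
      simpa using (hpow.const_sub 1).const_mul ((1 / 3 : ℝ) ^ m)
    obtain ⟨j₀, hj₀⟩ := eventually_atTop.1
      ((hlim.eventually_const_lt ht).and (hinv.eventually_lt_const hε))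
    set j := 2 * (j₀ + n₀) + 1 with hj
    obtain ⟨h1, h2⟩ := hj₀ j (by omega)
    have hlt := hNj j
    refine ⟨N j (M j), by omega, ?_⟩
    have h3 := distFun_le_of_near_one p hp x (n := N j (M j)) (M := M j)
      (fun k hk hk' => (hx j k hk (by rw [hMs]; omega)).2 (odd_two_mul_add_one _)) h1.le
      (sub_nonneg.2 (pow_le_one₀ (by norm_num) (by norm_num)))
    have h4 := hN j (M j)
    linarith

lemma exists_distArea_eq (p : unitInterval) (hp : (1 / 2 : ℝ) < p) :
    ∃ x : Set.Icc (0 : ℝ) 1,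
      distArea zigzag third p x 0 = (6 * (p : ℝ) - 3) / (4 * (p : ℝ) - 1) := by
  obtain ⟨x, hup, hlow⟩ := exists_extremal_point p hp
  refine ⟨x, le_antisymm (distArea_zigzag_third_le p hp x 0) ?_⟩
  have hp0 : (0 : ℝ) < p := by linarith
  have hq : (0 : ℝ) ≤ 1 - p := sub_nonneg.2 p.2.2
  have hr1 : (1 - p) / (p : ℝ) ≤ 1 := by rw [div_le_one hp0]; linarith
  rw [← integral_one_sub_scalePow p hp, distArea, sub_zero]
  refine intervalIntegral.integral_mono_ae_restrict zero_le_one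
    (intervalIntegrable_const.sub (intervalIntegrable_scalePow (by positivity) hr1 0 1))
    (intervalIntegrable_upper_sub_lower zigzag third p x 0 0 1) ?_
  -- The bound `hlow` needs `t < 3⁻ᵐ` strictly, whereas the floor gives only `t ≤ 3⁻ᵐ`; the
  -- exceptional powers of `1/3` form a null set.
  have hcount := (Set.countable_range fun m : ℕ => (1 / 3 : ℝ) ^ m).ae_notMem volume
  have h0 : ∀ᵐ t : ℝ, t ≠ 0 := Measure.ae_ne volume 0
  filter_upwards [ae_restrict_mem measurableSet_Icc, ae_restrict_of_ae hcount,
    ae_restrict_of_ae h0] with t ht hne ht0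
  have ht' : 0 < t := lt_of_le_of_ne ht.1 (Ne.symm ht0)
  have h1 := hup t ht'
  have h2 := hlow t ⌊Real.logb 3 t⁻¹⌋₊
    (lt_of_le_of_ne (le_pow_floor_logb ht' ht.2) fun h => hne ⟨_, h.symm⟩)
  rw [scalePow]
  linarith

lemma chaosMeasure_zigzag_third_eq_zero (p : unitInterval) (hp : (p : ℝ) ≤ 1 / 2) :
    chaosMeasure zigzag third p = 0 := by
  simp [chaosMeasure, distArea_zigzag_third_eq_zero p hp]

lemma chaosMeasure_zigzag_third (p : unitInterval) (hp : (1 / 2 : ℝ) < p) :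
    chaosMeasure zigzag third p = (6 * (p : ℝ) - 3) / (4 * (p : ℝ) - 1) := by
  refine le_antisymm (ciSup_le fun q => ?_) ?_
  · simpa using distArea_zigzag_third_le p hp q.1 q.2
  · obtain ⟨x, hx⟩ := exists_distArea_eq p hp
    have h := le_ciSup (bddAbove_distArea zigzag third p) (x, 0)
    simpa [chaosMeasure, hx] using h

theorem proposition5p3 (p : unitInterval) :
    ((1 / 2 : ℝ) < p →
      ∃ x : ℕ → Set.Icc (0 : ℝ) 1,
        Tendsto
          (fun k : ℕ => ∫ t in (0 : ℝ)..1,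
            (upperDistFun zigzag third p (x k) 0 t - lowerDistFun zigzag third p (x k) 0 t))
          atTop (𝓝 ((6 * (p : ℝ) - 3) / (4 * (p : ℝ) - 1)))) ∧
    ((p : ℝ) < 1 / 2 → chaosMeasure zigzag third p = 0) ∧
    ((1 / 2 : ℝ) ≤ p →
      chaosMeasure zigzag third p = (6 * (p : ℝ) - 3) / (4 * (p : ℝ) - 1)) := by
  refine ⟨fun hp => ?_, fun hp => chaosMeasure_zigzag_third_eq_zero p hp.le, fun hp => ?_⟩
  · obtain ⟨x, hx⟩ := exists_distArea_eq p hp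
    -- The value is attained, so a constant sequence suffices.
    refine ⟨fun _ => x, ?_⟩
    rw [distArea, sub_zero] at hx
    simp only [hx]
    exact tendsto_const_nhds
  · rcases hp.eq_or_lt with hp | hp
    · rw [chaosMeasure_zigzag_third_eq_zero p hp.ge, ← hp]
      norm_num
    · exact chaosMeasure_zigzag_third p hp
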